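/- Let $d\sigma(t)=\frac{dt}{\sqrt{1-t^2}}$ on $[-1,1]$, let $n>1$ be an integer, let $\pi_n$ be the monic orthogonal polynomial of degree $n$ for $d\sigma$, and let $d\widehat\sigma_n=\pi_n^2\,d\sigma$ be the induced measure. Let $f$ be analytic in a (complex) neighborhood of $[-1,1]$, with Chebyshev coefficients $\alpha_k=\frac{2}{\pi}\int_{-1}^1\frac{f(t)T_k(t)}{\sqrt{1-t^2}}\,dt$, so that $f=\frac{\alpha_0}{2}+\sum_{k\ge1}\alpha_kT_k$, and let $$R_n^{[1]}(f)=\int_{-1}^1 f\,d\widehat\sigma_n-\sum_{\nu=1}^n A_\nu f(t_\nu)$$ be the remainder of the $n$-point Gauss quadrature rule for $d\widehat\sigma_n$ (the nodes $t_\nu$ are the zeros of the $n$-th orthogonal polynomial $\widehat\pi_{n,n}$ of $d\widehat\sigma_n$). Then $$R_n^{[1]}(f)=\frac{1}{2^{2n-2}}\sum_{k=0}^{\infty}\alpha_{2n+k}\,\epsilon_{n,k},$$ where the series converges absolutely and the real coefficients $\epsilon_{n,k}$ depend only on $n$ and $k$ and not on $f$. The odd-indexed coefficients $\epsilon_{n,2j+1}$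 $(j\ge 0)$ vanish (in particular when $f$ is even). More precisely, $\epsilon_{n,0}=\frac{3\pi}{4}$, $\epsilon_{n,2jn}=(-1)^j\frac{\pi}{2}$ for $j\ge1$, and $\epsilon_{n,k}=0$ for every $k$ that is not of the form $2jn$ with $j\ge0$. -/

import Mathlib

open MeasureTheory Polynomial

noncomputable section

/-- The monic orthogonal polynomial of degree `n` of a measure `μ` on the real line (finite moments,
infinite support), built by the Gram--Schmidt process from the monomials:
`π_n = X^n - ∑_{k < n} (⟨X^n, π_k⟩ / ⟨π_k, π_k⟩) π_k` with `⟨p, q⟩ = ∫ p q dμ`. -/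
def monicOrthPoly (μ : Measure ℝ) (n : ℕ) : ℝ[X] :=
  X ^ n - ∑ k : Fin n,
    C ((∫ t, t ^ n * (monicOrthPoly μ k).eval t ∂μ) / ∫ t, ((monicOrthPoly μ k).eval t) ^ 2 ∂μ) *
      monicOrthPoly μ k
termination_by n
decreasing_by all_goals exact k.2

/-- The induced measure `dσ̂_n = π_n² dσ`, where `π_n` is the monic orthogonal polynomial of `σ`. -/
def inducedMeasure (σ : Measure ℝ) (n : ℕ) : Measure ℝ :=
  σ.withDensity fun t => ENNReal.ofReal (((monicOrthPoly σ n).eval t) ^ 2)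

/-- The nodes of the `m`-point Gauss quadrature rule of `μ`: the zeros of the `m`-th orthogonal
polynomial. -/
def gaussNodes (μ : Measure ℝ) (m : ℕ) : Finset ℝ :=
  (monicOrthPoly μ m).roots.toFinset

/-- The weight of the `m`-point Gauss quadrature rule of `μ` at the node `x`: the integral of the
Lagrange basis polynomial of `x` on the nodes. -/
def gaussWeight (μ : Measure ℝ) (m : ℕ) (x : ℝ) : ℝ :=
  ∫ t, (Lagrange.basis (gaussNodes μ m) id x).eval t ∂μ

/-- The `m`-point Gauss quadrature rule of `μ`, applied to `g`. -/
def gaussRule (μ : Measure ℝ) (m : ℕ) (g : ℝ → ℂ) : ℂ :=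
  ∑ x ∈ gaussNodes μ m, (gaussWeight μ m x : ℂ) * g x

/-- The remainder of the `m`-point Gauss quadrature rule of `μ`. -/
def gaussRemainder (μ : Measure ℝ) (m : ℕ) (g : ℝ → ℂ) : ℂ :=
  (∫ t, g t ∂μ) - gaussRule μ m g

/-- The remainder of the `n`-point Gauss rule for the measure induced by the Chebyshev measure of
the first kind, `Polynomial.Chebyshev.measureT`, that is `dt / √(1 - t²)` on `[-1, 1]`, and its own
`n`-th orthogonal polynomial. -/
def remainderT (n : ℕ) (f : ℂ → ℂ) : ℂ :=
  gaussRemainder (inducedMeasure Polynomial.Chebyshev.measureT n) n fun t => f t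

/-- The Chebyshev coefficients `α_k = (2 / π) ∫_{-1}^1 f(t) T_k(t) / √(1 - t²) dt` of `f`, so that
`f = α_0 / 2 + ∑_{k ≥ 1} α_k T_k`. -/
def chebyshevCoeff (f : ℂ → ℂ) (k : ℕ) : ℂ :=
  (2 / Real.pi : ℝ) *
    ∫ t : ℝ, f t * (((Polynomial.Chebyshev.T ℝ k).eval t : ℝ) : ℂ) ∂Polynomial.Chebyshev.measureT

end

/-! Everything rests on T_n² = (1 + T_{2n})/2. Expanding T_n² T_j T_k into single Chebyshev
polynomials shows that T_0, ..., T_n stay orthogonal under T_n² dσ. So the `n`-th orthogonal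
polynomial of the induced measure is again T_n up to scaling, and the nodes are the classical
Chebyshev nodes. T_{2n} is orthogonal to the Lagrange basis polynomials, so each weight is half the
classical one, up to the factor 2^{-(2n-2)}.

The scaled remainder is therefore (π/4)(α_0 + α_{2n}) - (π/2n) ∑ f(t_i) (`remainderT_eq`). Summing
the Chebyshev series over the nodes kills T_k unless 2n divides k, while T_{2jn} = (-1)^j at every
node. The α_0 terms cancel, and α_{2n} receives π/4 + π/2 = 3π/4. Absolute convergence comes from
the Fourier series of the smooth even function θ ↦ f(cos θ). -/

open Polynomial.Chebyshev

/-! ### Gram–Schmidt and orthogonal polynomial sequences -/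

/-- Integration against `μ`, as a linear functional on polynomials. -/
noncomputable def momentFunctional (μ : Measure ℝ)
    (hμ : ∀ p : ℝ[X], Integrable (fun t => p.eval t) μ) : ℝ[X] →ₗ[ℝ] ℝ where
  toFun p := ∫ t, p.eval t ∂μ
  map_add' p q := by
    simp only [eval_add]
    exact integral_add (hμ p) (hμ q)
  map_smul' c p := by
    simp only [eval_smul, smul_eq_mul, RingHom.id_apply]
    exact integral_const_mul _ _

theorem momentFunctional_apply (μ : Measure ℝ)
    (hμ : ∀ p : ℝ[X], Integrable (fun t => p.eval t) μ) (p : ℝ[X]) :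
    momentFunctional μ hμ p = ∫ t, p.eval t ∂μ := rfl

theorem monicOrthPoly_eq_momentFunctional (μ : Measure ℝ)
    (hμ : ∀ p : ℝ[X], Integrable (fun t => p.eval t) μ) (n : ℕ) :
    monicOrthPoly μ n = X ^ n - ∑ k ∈ Finset.range n,
      (momentFunctional μ hμ (X ^ n * monicOrthPoly μ k) /
        momentFunctional μ hμ (monicOrthPoly μ k ^ 2)) • monicOrthPoly μ k := by
  conv_lhs => rw [monicOrthPoly]
  rw [← Fin.sum_univ_eq_sum_range (fun k => (momentFunctional μ hμ (X ^ n * monicOrthPoly μ k) /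
        momentFunctional μ hμ (monicOrthPoly μ k ^ 2)) • monicOrthPoly μ k)]
  simp only [momentFunctional_apply, eval_mul, eval_pow, eval_X, smul_eq_C_mul]

/-- A polynomial sequence that is orthogonal up to the index `N` is, up to the leading coefficients,
the sequence of monic orthogonal polynomials up to the index `N`. -/
theorem monicOrthPoly_eq_of_orthogonal (μ : Measure ℝ)
    (hμ : ∀ p : ℝ[X], Integrable (fun t => p.eval t) μ) (S : Polynomial.Sequence ℝ) (N : ℕ)
    (horth : ∀ j k, j < k → k ≤ N → ∫ t, (S j * S k).eval t ∂μ = 0)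
    (hnorm : ∀ j, j < N → ∫ t, (S j * S j).eval t ∂μ ≠ 0) (k : ℕ) (hk : k ≤ N) :
    monicOrthPoly μ k = (S k).leadingCoeff⁻¹ • S k := by
  induction k using Nat.strong_induction_on with
  | _ k ih =>
  set φ := momentFunctional μ hμ with hφ
  have horth' : ∀ i j, i ≤ N → j ≤ N → i ≠ j → φ (S i * S j) = 0 := by
    intro i j hi hj hij
    rcases lt_or_gt_of_ne hij with h | h
    · exact horth i j h hj
    · rw [mul_comm]; exact horth j i h hi
  have hnorm' : ∀ j, j < N → φ (S j * S j) ≠ 0 := hnorm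
  have hlc : ∀ j, (S j).leadingCoeff ≠ 0 := fun j => leadingCoeff_ne_zero.2 (S.ne_zero j)
  have hM : monicOrthPoly μ k = X ^ k - ∑ j ∈ Finset.range k,
      (φ (X ^ k * S j) / φ (S j * S j)) • S j := by
    rw [monicOrthPoly_eq_momentFunctional μ hμ]
    congr 1
    refine Finset.sum_congr rfl fun j hj => ?_
    have hjk := Finset.mem_range.1 hj
    rw [ih j hjk (by lia), ← hφ, smul_smul, sq, smul_mul_smul_comm, mul_smul_comm, map_smul,
      map_smul, smul_eq_mul, smul_eq_mul]
    congr 1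
    have := hlc j
    have := hnorm' j (by lia)
    field_simp
  -- Both polynomials are monic of degree `k`, so their difference lies in the span of the lower `S
  -- j`; pairing it with each `S i` then kills every coefficient.
  have hdeg : monicOrthPoly μ k - (S k).leadingCoeff⁻¹ • S k ∈ degreeLT ℝ k := by
    have h1 : X ^ k - (S k).leadingCoeff⁻¹ • S k ∈ degreeLT ℝ k := by
      rw [mem_degreeLT]
      have hd : ((S k).leadingCoeff⁻¹ • S k).degree = k := by
        rw [smul_eq_C_mul, degree_C_mul (inv_ne_zero (hlc k)), S.degree_eq]
      have := degree_sub_lt_left (p := (X : ℝ[X]) ^ k) (q := (S k).leadingCoeff⁻¹ • S k)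
        (by rw [hd, degree_X_pow]) (pow_ne_zero _ X_ne_zero)
        (by rw [leadingCoeff_X_pow, smul_eq_C_mul, leadingCoeff_mul, leadingCoeff_C,
          inv_mul_cancel₀ (hlc k)])
      rwa [degree_X_pow] at this
    rw [hM, sub_right_comm]
    refine Submodule.sub_mem _ h1 (Submodule.sum_mem _ fun j hj => Submodule.smul_mem _ _ ?_)
    rw [mem_degreeLT, S.degree_eq]
    exact_mod_cast Finset.mem_range.1 hj
  rw [← Polynomial.Sequence.span_degreeLT S (fun i _ => (hlc i).isUnit),
    show Set.Iio k = (Finset.range k : Set ℕ) by simp,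
    Submodule.mem_span_image_finset_iff_exists_fun'] at hdeg
  obtain ⟨c, hc⟩ := hdeg
  have hpair : ∀ (d : ℕ → ℝ) (i : ℕ), i < k →
      φ ((∑ j ∈ Finset.range k, d j • S j) * S i) = d i * φ (S i * S i) := by
    intro d i hi
    rw [Finset.sum_mul, map_sum, Finset.sum_eq_single i]
    · rw [smul_mul_assoc, map_smul, smul_eq_mul]
    · intro j hj hji
      rw [smul_mul_assoc, map_smul, horth' j i (by have := Finset.mem_range.1 hj; lia) (by lia) hji,
        smul_zero]
    · intro h; exact absurd (Finset.mem_range.2 hi) h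
  have hzero : ∀ i ∈ Finset.range k, c i • S i = 0 := by
    intro i hi
    have hik := Finset.mem_range.1 hi
    have h1 := hpair c i hik
    have h2 := hnorm' i (by lia)
    rw [hc, hM, sub_mul, sub_mul, map_sub, map_sub, hpair _ i hik, smul_mul_assoc, map_smul,
      horth' k i hk (by lia) (by lia), div_mul_cancel₀ _ h2, sub_self, smul_zero, sub_zero] at h1
    rw [(mul_eq_zero.1 h1.symm).resolve_right h2, zero_smul]
  rw [Finset.sum_eq_zero hzero] at hc
  exact sub_eq_zero.1 hc.symm

/-! ### The induced Chebyshev measure and its orthogonal polynomials -/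

theorem integrable_eval_measureT (p : ℝ[X]) : Integrable (fun t => p.eval t) measureT :=
  integrable_measureT p.continuous.continuousOn

theorem leadingCoeff_T_natCast (n : ℕ) : (T ℝ n).leadingCoeff = 2 ^ (n - 1) := by
  simp [leadingCoeff_T]

theorem monicOrthPoly_measureT (n : ℕ) :
    monicOrthPoly measureT n = ((2 : ℝ) ^ (n - 1))⁻¹ • T ℝ n := by
  have := monicOrthPoly_eq_of_orthogonal measureT integrable_eval_measureT (chebyshevTsequence ℝ) n
    (fun j k hjk _ => by
      simpa using! integral_eval_T_real_mul_eval_T_real_measureT_of_ne hjk.ne)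
    (fun j _ => by
      have : ∫ x, (T ℝ j).eval x * (T ℝ j).eval x ∂measureT ≠ 0 := by
        rcases eq_or_ne j 0 with rfl | hj
        · have := integral_eval_T_real_mul_self_measureT_zero
          simp only [Nat.cast_zero, this]
          exact Real.pi_ne_zero
        · rw [integral_T_real_mul_self_measureT_of_ne_zero hj]
          positivity
      simpa using! this) n le_rfl
  rwa [show (chebyshevTsequence ℝ) n = T ℝ n from rfl, leadingCoeff_T_natCast] at this

theorem inducedMeasure_measureT (n : ℕ) :
    inducedMeasure measureT n = measureT.withDensity fun t =>
      ENNReal.ofReal ((2 ^ (2 * (n - 1)))⁻¹ * ((T ℝ n).eval t) ^ 2) := by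
  rw [inducedMeasure, monicOrthPoly_measureT]
  congr! 3
  rw [eval_smul, smul_eq_mul, mul_pow, inv_pow, ← pow_mul, mul_comm 2]

theorem integral_inducedMeasure_measureT {E : Type*} [NormedAddCommGroup E] [NormedSpace ℝ E]
    (n : ℕ) (g : ℝ → E) :
    ∫ t, g t ∂(inducedMeasure measureT n) =
      ((2 : ℝ) ^ (2 * (n - 1)))⁻¹ • ∫ t, ((T ℝ n).eval t) ^ 2 • g t ∂measureT := by
  rw [inducedMeasure_measureT, integral_withDensity_eq_integral_toReal_smul (by fun_prop)
    (.of_forall fun _ => ENNReal.ofReal_lt_top),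
    ← integral_smul]
  congr! 2 with t
  rw [ENNReal.toReal_ofReal (by positivity), mul_smul]

theorem integrable_eval_inducedMeasure_measureT (n : ℕ) (p : ℝ[X]) :
    Integrable (fun t => p.eval t) (inducedMeasure measureT n) := by
  rw [inducedMeasure_measureT, integrable_withDensity_iff_integrable_smul' (by fun_prop)
    (.of_forall fun _ => ENNReal.ofReal_lt_top)]
  refine (integrable_eval_measureT (C (2 ^ (2 * (n - 1)))⁻¹ * T ℝ n ^ 2 * p)).congr
    (.of_forall fun t => ?_)
  simp only [eval_mul, eval_C, eval_pow, smul_eq_mul]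
  rw [ENNReal.toReal_ofReal (by positivity)]

theorem T_sq_mul_T_mul_T (n j k : ℤ) : (T ℝ n) ^ 2 * (T ℝ j * T ℝ k) = (1 / 8 : ℝ) •
    (T ℝ (j + k + 2 * n) + T ℝ (j + k - 2 * n) + (T ℝ (j - k + 2 * n) + T ℝ (j - k - 2 * n)) +
      (2 : ℝ) • T ℝ (j + k) + (2 : ℝ) • T ℝ (j - k)) := by
  have h1 := T_mul_T ℝ j k
  have h2 := T_mul_T ℝ n n
  have h3 := T_mul_T ℝ (j + k) (2 * n)
  have h4 := T_mul_T ℝ (j - k) (2 * n)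
  rw [sub_self, T_zero, ← two_mul] at h2
  rw [← h3, ← h4]
  have h8 : (8 : ℝ[X]) * ((T ℝ n) ^ 2 * (T ℝ j * T ℝ k)) =
      2 * T ℝ (j + k) * T ℝ (2 * n) + 2 * T ℝ (j - k) * T ℝ (2 * n) + 2 * T ℝ (j + k) +
        2 * T ℝ (j - k) := by
    linear_combination (4 * T ℝ n ^ 2) * h1 + 2 * (T ℝ (j + k) + T ℝ (j - k)) * h2
  have h2C : ∀ p : ℝ[X], (2 : ℝ) • p = 2 * p := fun p => by rw [smul_eq_C_mul]; rfl
  rw [h2C, h2C, ← h8, show (8 : ℝ[X]) = Polynomial.C 8 from rfl, ← smul_eq_C_mul, smul_smul]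
  norm_num

/-- None of the six indices in the expansion is 0. The bound `k ≤ n` matters: j = n - 1, k = n + 1
would make j + k - 2n vanish. -/
theorem integral_T_sq_mul_T_mul_T_of_lt {n j k : ℕ} (hjk : j < k) (hk : k ≤ n) :
    ∫ t, ((T ℝ n) ^ 2 * (T ℝ j * T ℝ k)).eval t ∂measureT = 0 := by
  rw [T_sq_mul_T_mul_T, ← momentFunctional_apply _ integrable_eval_measureT]
  simp only [map_smul, map_add, momentFunctional_apply]
  iterate 6 rw [integral_eval_T_real_measureT_of_ne_zero (by lia)]
  simp

/-- The term 2 T_{j-j} = 2 T_0 contributes a positive integral; the only other term that can survive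
is 2 T_{2j}, when `j = 0`, and it is nonnegative. -/
theorem integral_T_sq_mul_T_mul_self_pos {n j : ℕ} (hj : j < n) :
    0 < ∫ t, ((T ℝ n) ^ 2 * (T ℝ j * T ℝ j)).eval t ∂measureT := by
  rw [T_sq_mul_T_mul_T, ← momentFunctional_apply _ integrable_eval_measureT, sub_self]
  simp only [map_smul, map_add, momentFunctional_apply]
  have h0 : 0 ≤ ∫ t, (T ℝ (j + j)).eval t ∂measureT := by
    rcases eq_or_ne j 0 with rfl | h
    · simp
    · rw [integral_eval_T_real_measureT_of_ne_zero (by lia)]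
  rw [integral_eval_T_real_measureT_of_ne_zero (n := j + j + 2 * n) (by lia),
    integral_eval_T_real_measureT_of_ne_zero (n := j + j - 2 * n) (by lia),
    integral_eval_T_real_measureT_of_ne_zero (n := 0 + 2 * n) (by lia),
    integral_eval_T_real_measureT_of_ne_zero (n := 0 - 2 * n) (by lia),
    integral_eval_T_real_measureT_zero]
  simp only [smul_eq_mul]
  have := Real.pi_pos
  linarith

theorem monicOrthPoly_inducedMeasure_measureT (n : ℕ) :
    monicOrthPoly (inducedMeasure measureT n) n = ((2 : ℝ) ^ (n - 1))⁻¹ • T ℝ n := by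
  have hint : ∀ p : ℝ[X], ∫ t, p.eval t ∂(inducedMeasure measureT n) =
      ((2 : ℝ) ^ (2 * (n - 1)))⁻¹ * ∫ t, ((T ℝ n) ^ 2 * p).eval t ∂measureT := by
    intro p
    rw [integral_inducedMeasure_measureT]
    simp only [eval_mul, eval_pow, smul_eq_mul]
  have := monicOrthPoly_eq_of_orthogonal (inducedMeasure measureT n)
    (integrable_eval_inducedMeasure_measureT n) (chebyshevTsequence ℝ) n
    (fun j k hjk hk => by
      rw [hint]
      exact mul_eq_zero_of_right _ (integral_T_sq_mul_T_mul_T_of_lt hjk hk))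
    (fun j hj => by
      rw [hint]
      exact mul_ne_zero (by positivity) (integral_T_sq_mul_T_mul_self_pos hj).ne') n le_rfl
  rwa [show (chebyshevTsequence ℝ) n = T ℝ n from rfl, leadingCoeff_T_natCast] at this

/-! ### Nodes and weights of the Gauss rule -/

/-- The `i`-th zero of the Chebyshev polynomial `T n`. -/
noncomputable def chebyshevNode (n i : ℕ) : ℝ :=
  Real.cos ((2 * i + 1) / (2 * n) * Real.pi)

theorem chebyshevNode_mem_Icc (n i : ℕ) : chebyshevNode n i ∈ Set.Icc (-1 : ℝ) 1 :=
  Real.cos_mem_Icc _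

theorem sumZeroes_eq_sum_chebyshevNode (n : ℕ) (p : ℝ[X]) :
    sumZeroes n p = (Real.pi / n) * ∑ i ∈ Finset.range n, p.eval (chebyshevNode n i) := rfl

theorem chebyshevNode_eq (n i : ℕ) :
    chebyshevNode n i = Real.cos ((2 * i + 1) * Real.pi / (2 * n)) := by
  rw [chebyshevNode, div_mul_eq_mul_div]

theorem injOn_chebyshevNode (n : ℕ) : Set.InjOn (chebyshevNode n) (Finset.range n) := by
  have := (Finset.range n).nodup_map_iff_injOn.mp (roots_T_real_nodup n)
  simpa only [← chebyshevNode_eq] using! this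

theorem gaussNodes_inducedMeasure_measureT (n : ℕ) :
    gaussNodes (inducedMeasure measureT n) n = (Finset.range n).image (chebyshevNode n) := by
  rw [gaussNodes, monicOrthPoly_inducedMeasure_measureT,
    roots_smul_nonzero _ (by positivity), roots_T_real]
  simp only [← chebyshevNode_eq]
  ext
  simp

/-- The product has degree below 2n, where the classical Gauss–Chebyshev rule is exact, and it
vanishes at all the nodes. -/
theorem integral_mul_T_eq_zero_of_degree_lt {n : ℕ} {p : ℝ[X]} (hn : n ≠ 0)
    (hp : p.degree < n) : ∫ t, (p * T ℝ n).eval t ∂measureT = 0 := by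
  rw [integral_eq_sumZeroes hn, sumZeroes_eq_sum_chebyshevNode, Finset.sum_eq_zero, mul_zero]
  · intro i hi
    have : chebyshevNode n i ∈ (T ℝ n).roots := by
      rw [roots_T_real, chebyshevNode_eq]
      exact Finset.mem_def.1 (Finset.mem_image.2 ⟨i, hi, rfl⟩)
    rw [eval_mul, (mem_roots'.1 this).2.eq_zero, mul_zero]
  · rw [degree_mul, degree_T, Int.natAbs_natCast, two_mul]
    exact WithBot.add_lt_add_right (by simp) hp

theorem T_sq (n : ℤ) : (T ℝ n) ^ 2 = (1 / 2 : ℝ) • (1 + T ℝ (2 * n)) := by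
  have h2 := T_mul_T ℝ n n
  rw [sub_self, T_zero, ← two_mul] at h2
  rw [add_comm, ← h2, mul_assoc, show (2 : ℝ[X]) = Polynomial.C 2 from rfl, ← smul_eq_C_mul,
    smul_smul, sq]
  norm_num

theorem gaussWeight_inducedMeasure_measureT {n i : ℕ} (hi : i < n) :
    gaussWeight (inducedMeasure measureT n) n (chebyshevNode n i) =
      ((2 : ℝ) ^ (2 * (n - 1)))⁻¹ * (Real.pi / (2 * n)) := by
  have hn : n ≠ 0 := by lia
  have hmem : chebyshevNode n i ∈ (Finset.range n).image (chebyshevNode n) :=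
    Finset.mem_image_of_mem _ (Finset.mem_range.2 hi)
  rw [gaussWeight, gaussNodes_inducedMeasure_measureT, integral_inducedMeasure_measureT, smul_eq_mul]
  congr 1
  set p := Lagrange.basis ((Finset.range n).image (chebyshevNode n)) id (chebyshevNode n i) with hpdef
  have hdeg : p.degree < n := by
    rw [hpdef, Lagrange.degree_basis (Function.injective_id.injOn) hmem,
      Finset.card_image_of_injOn (injOn_chebyshevNode n), Finset.card_range]
    exact_mod_cast Nat.sub_lt (by lia) one_pos
  have h2 : ∀ t, ((T ℝ n).eval t) ^ 2 • p.eval t =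
      ((1 / 2 : ℝ) • (p + p * T ℝ ((2 * n : ℕ) : ℤ))).eval t := by
    intro t
    rw [← eval_pow, smul_eq_mul, ← eval_mul, T_sq, smul_mul_assoc, add_mul, one_mul,
      mul_comm (T _ _)]
    norm_cast
  simp_rw [h2]
  rw [← momentFunctional_apply _ integrable_eval_measureT]
  simp only [map_smul, map_add, momentFunctional_apply]
  -- The T_{2n} half vanishes by orthogonality; the other half is computed by the classical rule,
  -- leaving half of π/n.
  have hd2 : ((n : ℕ) : WithBot ℕ) ≤ ((2 * n : ℕ) : WithBot ℕ) := by
    exact_mod_cast (by lia : n ≤ 2 * n)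
  rw [integral_mul_T_eq_zero_of_degree_lt (by lia) (hdeg.trans_le hd2),
    integral_eq_sumZeroes hn (hdeg.trans_le (by exact_mod_cast hd2)),
    sumZeroes_eq_sum_chebyshevNode, Finset.sum_eq_single i]
  · have := Lagrange.eval_basis_self (v := id) (Function.injective_id.injOn) hmem
    rw [id] at this
    rw [hpdef, this, smul_eq_mul]
    field_simp
    simp
  · intro j hj hji
    have hne : chebyshevNode n i ≠ chebyshevNode n j := fun h =>
      hji (injOn_chebyshevNode n (by simpa using! hj) (by simpa using! hi) h.symm)
    exact Lagrange.eval_basis_of_ne (v := id) hne (Finset.mem_image_of_mem _ hj)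
  · intro h; exact absurd (Finset.mem_range.2 hi) h

theorem gaussRule_inducedMeasure_measureT (n : ℕ) (g : ℝ → ℂ) :
    gaussRule (inducedMeasure measureT n) n g =
      (((2 : ℝ) ^ (2 * (n - 1)))⁻¹ * (Real.pi / (2 * n)) : ℝ) *
        ∑ i ∈ Finset.range n, g (chebyshevNode n i) := by
  rw [gaussRule, gaussNodes_inducedMeasure_measureT, Finset.sum_image (injOn_chebyshevNode n),
    Finset.mul_sum]
  refine Finset.sum_congr rfl fun i hi => ?_
  rw [gaussWeight_inducedMeasure_measureT (Finset.mem_range.1 hi)]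

/-! ### Decay of Fourier coefficients -/

theorem fourierCoeff_eq_integral_exp {g : ℝ → ℂ} (hg : Function.Periodic g (2 * Real.pi)) (n : ℤ)
    (a : ℝ) :
    haveI : Fact (0 < 2 * Real.pi) := ⟨Real.two_pi_pos⟩
    fourierCoeff hg.lift n = (1 / (2 * Real.pi)) •
      ∫ x in a..a + 2 * Real.pi, Complex.exp (-(n * x * Complex.I)) * g x := by
  have : Fact (0 < 2 * Real.pi) := ⟨Real.two_pi_pos⟩
  rw [fourierCoeff_eq_intervalIntegral _ _ a]
  congr 1
  refine intervalIntegral.integral_congr fun x _ => ?_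
  simp only [fourier_coe_apply, Function.Periodic.lift_coe, smul_eq_mul]
  congr 2
  push_cast
  field_simp

/-- Integration by parts for the Fourier coefficients of a periodic function. -/
theorem fourierCoeff_lift_of_hasDerivAt {g g' : ℝ → ℂ} (hg : Function.Periodic g (2 * Real.pi))
    (hg' : Function.Periodic g' (2 * Real.pi)) (hd : ∀ x, HasDerivAt g (g' x) x)
    (hc : Continuous g') {n : ℤ} (hn : n ≠ 0) :
    haveI : Fact (0 < 2 * Real.pi) := ⟨Real.two_pi_pos⟩
    fourierCoeff hg.lift n = (1 / (n * Complex.I)) * fourierCoeff hg'.lift n := by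
  have : Fact (0 < 2 * Real.pi) := ⟨Real.two_pi_pos⟩
  rw [fourierCoeff_eq_integral_exp hg n 0, fourierCoeff_eq_integral_exp hg' n 0, zero_add]
  have hnI : (n * Complex.I : ℂ) ≠ 0 := mul_ne_zero (by exact_mod_cast hn) Complex.I_ne_zero
  have hu : ∀ x : ℝ, HasDerivAt
      (fun x : ℝ => -(1 / (n * Complex.I)) * Complex.exp (-(n * x * Complex.I)))
      (Complex.exp (-(n * x * Complex.I))) x := by
    intro x
    have h1 : HasDerivAt (fun x : ℝ => -((n : ℂ) * x * Complex.I)) (-((n : ℂ) * 1 * Complex.I)) x :=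
      (((hasDerivAt_id x).ofReal_comp.const_mul (n : ℂ)).mul_const Complex.I).neg
    convert! h1.cexp.const_mul (-(1 / (n * Complex.I))) using 1
    field_simp
  have hibp := intervalIntegral.integral_mul_deriv_eq_deriv_mul (a := 0) (b := 2 * Real.pi)
    (fun x _ => hu x) (fun x _ => hd x)
    ((by fun_prop : Continuous fun x : ℝ =>
      Complex.exp (-(n * x * Complex.I))).intervalIntegrable _ _)
    (hc.intervalIntegrable _ _)
  have hexp : Complex.exp (-(n * (2 * Real.pi : ℝ) * Complex.I)) = 1 := by
    rw [Complex.exp_eq_one_iff]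
    exact ⟨-n, by push_cast; ring⟩
  have hg0 : g (2 * Real.pi) = g 0 := by simpa using hg 0
  rw [hexp, hg0] at hibp
  simp only [mul_assoc, intervalIntegral.integral_const_mul] at hibp
  simp only [mul_assoc]
  simp only [Complex.ofReal_zero, zero_mul, mul_zero, neg_zero, Complex.exp_zero,
    sub_self, zero_sub] at hibp
  rw [mul_smul_comm]
  congr 1
  linear_combination hibp

theorem norm_fourierCoeff_lift_le {g : ℝ → ℂ} (hg : Function.Periodic g (2 * Real.pi))
    {C : ℝ} (hC : ∀ x, ‖g x‖ ≤ C) (n : ℤ) :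
    haveI : Fact (0 < 2 * Real.pi) := ⟨Real.two_pi_pos⟩
    ‖fourierCoeff hg.lift n‖ ≤ C := by
  have : Fact (0 < 2 * Real.pi) := ⟨Real.two_pi_pos⟩
  rw [fourierCoeff_eq_integral_exp hg n 0, zero_add, norm_smul]
  have h := intervalIntegral.norm_integral_le_of_norm_le_const (a := 0) (b := 2 * Real.pi)
    (f := fun x => Complex.exp (-(n * x * Complex.I)) * g x) (C := C) (fun x _ => by
      rw [norm_mul, Complex.norm_exp]
      simpa using hC x)
  have hp := Real.two_pi_pos
  rw [sub_zero, abs_of_pos hp] at h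
  rw [Real.norm_of_nonneg (by positivity)]
  calc _ ≤ 1 / (2 * Real.pi) * (C * (2 * Real.pi)) := by gcongr
    _ = C := by field_simp

/-- The Fourier coefficients of a twice continuously differentiable function are summable. -/
theorem summable_fourierCoeff_lift_of_contDiff {g : ℝ → ℂ}
    (hg : Function.Periodic g (2 * Real.pi)) (hsm : ContDiff ℝ 2 g) :
    haveI : Fact (0 < 2 * Real.pi) := ⟨Real.two_pi_pos⟩
    Summable (fourierCoeff hg.lift) := by
  have : Fact (0 < 2 * Real.pi) := ⟨Real.two_pi_pos⟩
  have hper : ∀ h : ℝ → ℂ, Function.Periodic h (2 * Real.pi) →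
      Function.Periodic (deriv h) (2 * Real.pi) := by
    intro h hh x
    rw [← deriv_comp_add_const, funext hh]
  have hsm1 : ContDiff ℝ 1 (deriv g) :=
    ((contDiff_succ_iff_deriv (n := 1)).1 (by simpa using! hsm)).2.2
  have hc2 : Continuous (deriv (deriv g)) := hsm1.continuous_deriv le_rfl
  have hg1 := hper g hg
  have hg2 := hper _ hg1
  obtain ⟨C, hC⟩ := (isCompact_Icc (a := (0 : ℝ)) (b := 2 * Real.pi)).exists_bound_of_continuousOn
    hc2.continuousOn
  have hC' : ∀ x, ‖deriv (deriv g) x‖ ≤ C := by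
    intro x
    obtain ⟨y, hy, hxy⟩ := hg2.exists_mem_Ico₀ Real.two_pi_pos x
    rw [hxy]
    exact hC y (Set.Ico_subset_Icc_self hy)
  have hs : Summable fun n : ℤ => C * (1 / (n : ℝ) ^ 2) :=
    (Real.summable_one_div_int_pow.2 one_lt_two).mul_left C
  -- At `n = 0` the majorant is 0 by the convention for division, so the comparison is made off a
  -- finite set. There, two integrations by parts give the factor 1/n².
  refine Summable.of_norm_bounded_eventually hs ?_
  filter_upwards [(Set.finite_singleton (0 : ℤ)).compl_mem_cofinite] with n hn
  have hn0 : n ≠ 0 := hn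
  rw [fourierCoeff_lift_of_hasDerivAt hg hg1
      (fun x => (hsm.differentiable (by simp) x).hasDerivAt) hsm1.continuous hn0,
    fourierCoeff_lift_of_hasDerivAt hg1 hg2
      (fun x => (hsm1.differentiable (by simp) x).hasDerivAt) hc2 hn0, ← mul_assoc, norm_mul]
  have := norm_fourierCoeff_lift_le hg2 hC' n
  have h1 : ‖(1 / (n * Complex.I) * (1 / (n * Complex.I)) : ℂ)‖ = 1 / (n : ℝ) ^ 2 := by
    simp only [norm_mul, norm_div, norm_one, Complex.norm_intCast, Complex.norm_I]
    rw [← sq_abs (n : ℝ)]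
    ring
  rw [h1, mul_comm C]
  gcongr

/-! ### Chebyshev series as cosine series -/

theorem integrable_measureT_complex {F : ℝ → ℂ} (hF : ContinuousOn F (Set.Icc (-1) 1)) :
    Integrable F measureT :=
  Integrable.re_im_iff.1 ⟨integrable_measureT (Complex.continuous_re.comp_continuousOn hF),
    integrable_measureT (Complex.continuous_im.comp_continuousOn hF)⟩

theorem integral_measureT_eq_integral_cos_complex {F : ℝ → ℂ}
    (hF : ContinuousOn F (Set.Icc (-1) 1)) :
    ∫ x, F x ∂measureT = ∫ θ in 0..Real.pi, F (Real.cos θ) := by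
  have hcos : Continuous fun θ => F (Real.cos θ) :=
    hF.comp_continuous Real.continuous_cos Real.cos_mem_Icc
  have hint : Integrable (fun θ => F (Real.cos θ)) (volume.restrict (Set.Ioc 0 Real.pi)) :=
    (intervalIntegrable_iff_integrableOn_Ioc_of_le Real.pi_pos.le).1 (hcos.intervalIntegrable _ _)
  rw [intervalIntegral.integral_of_le Real.pi_pos.le, ← integral_re_add_im hint,
    ← integral_re_add_im (integrable_measureT_complex hF), integral_measureT_eq_integral_cos,
    integral_measureT_eq_integral_cos, intervalIntegral.integral_of_le Real.pi_pos.le,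
    intervalIntegral.integral_of_le Real.pi_pos.le]

theorem fourierCoeff_lift_of_even {g : ℝ → ℂ} (hg : Function.Periodic g (2 * Real.pi))
    (he : Function.Even g) (hc : Continuous g) (n : ℤ) :
    haveI : Fact (0 < 2 * Real.pi) := ⟨Real.two_pi_pos⟩
    fourierCoeff hg.lift n = (1 / Real.pi) • ∫ x in 0..Real.pi, g x * (Real.cos (n * x) : ℂ) := by
  have : Fact (0 < 2 * Real.pi) := ⟨Real.two_pi_pos⟩
  rw [fourierCoeff_eq_integral_exp hg n (-Real.pi), show -Real.pi + 2 * Real.pi = Real.pi by ring]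
  have hi : ∀ a b : ℝ, IntervalIntegrable
      (fun x : ℝ => Complex.exp (-(n * x * Complex.I)) * g x) volume a b :=
    fun a b => (by fun_prop : Continuous _).intervalIntegrable _ _
  have hi' : ∀ a b : ℝ, IntervalIntegrable
      (fun x : ℝ => Complex.exp (n * x * Complex.I) * g x) volume a b :=
    fun a b => (by fun_prop : Continuous _).intervalIntegrable _ _
  have hneg : ∫ x in (-Real.pi)..0, Complex.exp (-(n * x * Complex.I)) * g x =
      ∫ x in 0..Real.pi, Complex.exp (n * x * Complex.I) * g x := by
    have := intervalIntegral.integral_comp_neg (a := 0) (b := Real.pi)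
      (fun x : ℝ => Complex.exp (-(n * x * Complex.I)) * g x)
    rw [neg_zero] at this
    rw [← this]
    refine intervalIntegral.integral_congr fun x _ => ?_
    simp only [he x]
    congr 2
    push_cast
    ring
  rw [← intervalIntegral.integral_add_adjacent_intervals (hi _ 0) (hi 0 _), hneg,
    ← intervalIntegral.integral_add (hi' _ _) (hi _ _)]
  have : ∀ x : ℝ, Complex.exp (n * x * Complex.I) * g x + Complex.exp (-(n * x * Complex.I)) * g x =
      (2 : ℝ) • (g x * (Real.cos (n * x) : ℂ)) := by
    intro x
    rw [Complex.ofReal_cos, Complex.cos, Complex.real_smul]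
    push_cast
    ring_nf
  simp_rw [this]
  rw [intervalIntegral.integral_smul, smul_smul]
  congr 1
  field_simp

theorem contDiff_comp_cos {f : ℂ → ℂ}
    (hf : AnalyticOnNhd ℂ f (Complex.ofReal '' Set.Icc (-1 : ℝ) 1)) {m : WithTop ℕ∞} :
    ContDiff ℝ m fun θ : ℝ => f (Real.cos θ) := by
  rw [contDiff_iff_contDiffAt]
  intro θ
  have h1 : ContDiffAt ℝ m f (Real.cos θ : ℂ) :=
    ((hf _ ⟨_, Real.cos_mem_Icc θ, rfl⟩).contDiffAt).restrict_scalars ℝ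
  exact h1.comp θ (Complex.ofRealCLM.contDiff.comp Real.contDiff_cos).contDiffAt

theorem continuousOn_comp_ofReal {f : ℂ → ℂ}
    (hf : AnalyticOnNhd ℂ f (Complex.ofReal '' Set.Icc (-1 : ℝ) 1)) :
    ContinuousOn (fun t : ℝ => f t) (Set.Icc (-1) 1) :=
  hf.continuousOn.comp Complex.continuous_ofReal.continuousOn (Set.mapsTo_image _ _)

theorem chebyshevCoeff_eq_integral_cos {f : ℂ → ℂ}
    (hf : AnalyticOnNhd ℂ f (Complex.ofReal '' Set.Icc (-1 : ℝ) 1)) (k : ℕ) :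
    chebyshevCoeff f k = (2 / Real.pi : ℝ) *
      ∫ θ in 0..Real.pi, f (Real.cos θ) * (Real.cos (k * θ) : ℂ) := by
  rw [chebyshevCoeff, integral_measureT_eq_integral_cos_complex]
  · simp only [T_real_cos, Int.cast_natCast]
  · exact (continuousOn_comp_ofReal hf).mul
      (Complex.continuous_ofReal.comp (T ℝ k).continuous).continuousOn

/-- The Chebyshev series of an analytic function converges absolutely to the function. -/
theorem hasSum_chebyshevCoeff_mul_T {f : ℂ → ℂ}
    (hf : AnalyticOnNhd ℂ f (Complex.ofReal '' Set.Icc (-1 : ℝ) 1)) {x : ℝ}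
    (hx : x ∈ Set.Icc (-1 : ℝ) 1) :
    HasSum (fun k : ℕ => chebyshevCoeff f k * (((T ℝ k).eval x : ℝ) : ℂ))
      (f x + chebyshevCoeff f 0 / 2) := by
  have : Fact (0 < 2 * Real.pi) := ⟨Real.two_pi_pos⟩
  set g : ℝ → ℂ := fun θ => f (Real.cos θ) with hgdef
  have hper : Function.Periodic g (2 * Real.pi) := fun θ => by simp only [hgdef, Real.cos_add_two_pi]
  have heven : Function.Even g := fun θ => by simp only [hgdef, Real.cos_neg]
  have hsm : ContDiff ℝ 2 g := contDiff_comp_cos hf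
  have hcoeff : ∀ n : ℤ, fourierCoeff hper.lift n = chebyshevCoeff f n.natAbs / 2 := by
    intro n
    rw [fourierCoeff_lift_of_even hper heven hsm.continuous, chebyshevCoeff_eq_integral_cos hf,
      Complex.real_smul]
    have : ∀ θ : ℝ, Real.cos ((n.natAbs : ℝ) * θ) = Real.cos (n * θ) := by
      intro θ
      rcases Int.natAbs_eq n with h | h
      · conv_rhs => rw [h]
        simp
      · conv_rhs => rw [h]
        simp
    simp only [this]
    simp only [hgdef]
    push_cast
    ring
  let G : C(AddCircle (2 * Real.pi), ℂ) :=
    ⟨hper.lift, continuous_coinduced_dom.mpr hsm.continuous⟩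
  have hsum := has_pointwise_sum_fourier_series_of_summable (f := G)
    (summable_fourierCoeff_lift_of_contDiff hper hsm) (Real.arccos x : AddCircle (2 * Real.pi))
  have hG : G (Real.arccos x : AddCircle (2 * Real.pi)) = f x := by
    change f (Real.cos (Real.arccos x)) = f x
    rw [Real.cos_arccos hx.1 hx.2]
  rw [hG] at hsum
  -- Pairing `k` with `-k` counts index 0 twice, whence the extra α_0/2 in the sum.
  have := hsum.nat_add_neg
  have h0 : fourierCoeff G 0 • fourier 0 (Real.arccos x : AddCircle (2 * Real.pi)) =
      chebyshevCoeff f 0 / 2 := by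
    have := hcoeff 0
    simp only [fourier_zero, smul_eq_mul, mul_one]
    exact this
  rw [h0] at this
  refine this.congr_fun ?_
  intro k
  have hk := hcoeff k
  have hk' := hcoeff (-k)
  rw [Int.natAbs_natCast] at hk
  rw [Int.natAbs_neg, Int.natAbs_natCast] at hk'
  have hT : (((T ℝ k).eval x : ℝ) : ℂ) = Complex.cos (k * Real.arccos x) := by
    conv_lhs => rw [← Real.cos_arccos hx.1 hx.2, T_real_cos]
    push_cast
    rfl
  rw [hT]
  change _ = fourierCoeff hper.lift k • _ + fourierCoeff hper.lift (-k) • _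
  rw [hk, hk', Complex.cos, fourier_coe_apply, fourier_coe_apply]
  have hpi : (Real.pi : ℂ) ≠ 0 := by exact_mod_cast Real.pi_ne_zero
  have e1 : 2 * Real.pi * Complex.I * (k : ℤ) * Real.arccos x / (2 * Real.pi : ℝ) =
      k * Real.arccos x * Complex.I := by
    push_cast
    field_simp
  have e2 : 2 * Real.pi * Complex.I * (-k : ℤ) * Real.arccos x / (2 * Real.pi : ℝ) =
      -(k * Real.arccos x) * Complex.I := by
    push_cast
    field_simp
  rw [e1, e2, smul_eq_mul, smul_eq_mul]
  ring

/-! ### Node sums and the remainder -/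

theorem sumZeroes_T_two_mul_mul {n : ℕ} (hn : n ≠ 0) (j : ℕ) :
    sumZeroes n (T ℝ ((2 * j * n : ℕ) : ℤ)) = (-1) ^ j * Real.pi := by
  have hn' : (n : ℝ) ≠ 0 := by exact_mod_cast hn
  have : ∀ i ∈ Finset.range n, (T ℝ ((2 * j * n : ℕ) : ℤ)).eval (chebyshevNode n i) = (-1) ^ j := by
    intro i _
    rw [chebyshevNode, T_real_cos]
    have : (((2 * j * n : ℕ) : ℤ) : ℝ) * ((2 * i + 1) / (2 * n) * Real.pi) =
        j * Real.pi + (i * j : ℕ) * (2 * Real.pi) := by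
      push_cast
      field_simp
      ring
    rw [this, Real.cos_add_nat_mul_two_pi, Real.cos_nat_mul_pi]
  rw [sumZeroes_eq_sum_chebyshevNode, Finset.sum_congr rfl this]
  simp only [Finset.sum_const, Finset.card_range, nsmul_eq_mul]
  field_simp

/-- The remainder of the Gauss rule for the induced measure, in terms of the Chebyshev coefficients
and the Chebyshev nodes. -/
theorem remainderT_eq {n : ℕ} (hn : n ≠ 0) {f : ℂ → ℂ}
    (hf : AnalyticOnNhd ℂ f (Complex.ofReal '' Set.Icc (-1 : ℝ) 1)) :
    remainderT n f = 1 / 2 ^ (2 * n - 2) *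
      ((Real.pi / 4 : ℝ) * (chebyshevCoeff f 0 + chebyshevCoeff f (2 * n)) -
        (Real.pi / (2 * n) : ℝ) * ∑ i ∈ Finset.range n, f (chebyshevNode n i)) := by
  have hpi : (Real.pi : ℂ) ≠ 0 := by exact_mod_cast Real.pi_ne_zero
  have hcont := continuousOn_comp_ofReal hf
  have hint : ∀ k : ℤ, Integrable (fun t : ℝ => f t * (((T ℝ k).eval t : ℝ) : ℂ)) measureT :=
    fun k => integrable_measureT_complex (hcont.mul
      (Complex.continuous_ofReal.comp (T ℝ k).continuous).continuousOn)
  -- The constant 1 is written as T_0 so that `hcc` turns both integrals into Chebyshev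
  -- coefficients.
  have hsq : ∀ t : ℝ, ((T ℝ n).eval t) ^ 2 • f t = (1 / 2 : ℂ) *
      (f t * (((T ℝ (0 : ℕ)).eval t : ℝ) : ℂ) +
        f t * (((T ℝ ((2 * n : ℕ) : ℤ)).eval t : ℝ) : ℂ)) := by
    intro t
    rw [← eval_pow, T_sq, Complex.real_smul]
    simp only [eval_smul, eval_add, eval_one, Nat.cast_zero, T_zero, smul_eq_mul]
    push_cast
    ring
  have hcc : ∀ k : ℕ, ∫ t : ℝ, f t * (((T ℝ k).eval t : ℝ) : ℂ) ∂measureT =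
      (Real.pi / 2 : ℝ) * chebyshevCoeff f k := by
    intro k
    rw [chebyshevCoeff]
    push_cast
    field_simp
  rw [remainderT, gaussRemainder, gaussRule_inducedMeasure_measureT,
    integral_inducedMeasure_measureT]
  simp_rw [hsq]
  rw [integral_const_mul, integral_add (hint _) (hint _), hcc, hcc, Complex.real_smul,
    show 2 * n - 2 = 2 * (n - 1) by lia]
  push_cast
  ring

/-- Summing the Chebyshev series over the nodes: the terms of index between `0` and `2 * n` cancel. -/
theorem hasSum_chebyshevCoeff_mul_sumZeroes {n : ℕ} (hn : n ≠ 0) {f : ℂ → ℂ}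
    (hf : AnalyticOnNhd ℂ f (Complex.ofReal '' Set.Icc (-1 : ℝ) 1)) :
    HasSum (fun k : ℕ => chebyshevCoeff f (2 * n + k) *
        (sumZeroes n (T ℝ ((2 * n + k : ℕ) : ℤ)) : ℂ))
      ((Real.pi / n : ℝ) * ∑ i ∈ Finset.range n, f (chebyshevNode n i) -
        (Real.pi / 2 : ℝ) * chebyshevCoeff f 0) := by
  have h1 : HasSum (fun k : ℕ => chebyshevCoeff f k * (sumZeroes n (T ℝ k) : ℂ))
      ((Real.pi / n : ℝ) * ∑ i ∈ Finset.range n,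
        (f (chebyshevNode n i) + chebyshevCoeff f 0 / 2)) := by
    refine ((hasSum_sum fun i (_ : i ∈ Finset.range n) => hasSum_chebyshevCoeff_mul_T hf
      (chebyshevNode_mem_Icc n i)).mul_left ((Real.pi / n : ℝ) : ℂ)).congr_fun fun k => ?_
    rw [sumZeroes_eq_sum_chebyshevNode, ← Finset.mul_sum]
    push_cast
    ring
  have hz : ∀ k ∈ Finset.range (2 * n), k ≠ 0 →
      chebyshevCoeff f k * (sumZeroes n (T ℝ k) : ℂ) = 0 := by
    intro k hk hk0
    rw [sumZeroes_T_of_not_dvd, Complex.ofReal_zero, mul_zero]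
    intro h
    have := Nat.le_of_dvd (Nat.pos_of_ne_zero hk0) (by exact_mod_cast h : 2 * n ∣ k)
    have := Finset.mem_range.1 hk
    lia
  have hs : ∑ k ∈ Finset.range (2 * n), chebyshevCoeff f k * (sumZeroes n (T ℝ k) : ℂ) =
      chebyshevCoeff f 0 * Real.pi := by
    rw [Finset.sum_eq_single 0 hz (fun h => absurd (Finset.mem_range.2 (by lia)) h), Nat.cast_zero,
      sumZeroes_T_zero hn]
  -- The halves α_0/2 at the nodes add up to πα_0/2, and the dropped initial terms remove πα_0; the
  -- balance is -πα_0/2.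
  have h2 := (hasSum_nat_add_iff' (2 * n)).2 h1
  rw [hs] at h2
  simp only [add_comm _ (2 * n)] at h2
  convert! h2 using 1
  rw [Finset.sum_add_distrib, Finset.sum_const, Finset.card_range, nsmul_eq_mul]
  have : (n : ℂ) ≠ 0 := by exact_mod_cast hn
  push_cast
  field_simp
  ring

theorem theorem5p4 (n : ℕ) (hn : 1 < n) :
    ∃ ε : ℕ → ℝ,
      (∀ f : ℂ → ℂ, AnalyticOnNhd ℂ f (Complex.ofReal '' Set.Icc (-1 : ℝ) 1) →
        Summable (fun k : ℕ => chebyshevCoeff f (2 * n + k) * (ε k : ℂ)) ∧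
        remainderT n f =
          1 / 2 ^ (2 * n - 2) * ∑' k : ℕ, chebyshevCoeff f (2 * n + k) * (ε k : ℂ)) ∧
      (∀ j : ℕ, ε (2 * j + 1) = 0) ∧
      ε 0 = 3 * Real.pi / 4 ∧
      (∀ j : ℕ, 1 ≤ j → ε (2 * j * n) = (-1) ^ j * (Real.pi / 2)) ∧
      (∀ k : ℕ, (∀ j : ℕ, k ≠ 2 * j * n) → ε k = 0) := by
  have hn0 : n ≠ 0 := by lia
  -- The π/4 is the coefficient of α_{2n} from integrating f T_n²; the other term is minus half the
  -- node sum, because the weights are halved.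
  set ε : ℕ → ℝ := fun k =>
    (if k = 0 then Real.pi / 4 else 0) - (1 / 2) * sumZeroes n (T ℝ ((2 * n + k : ℕ) : ℤ)) with hε
  have hzero : ∀ k : ℕ, (∀ j : ℕ, k ≠ 2 * j * n) → ε k = 0 := by
    intro k hk
    have hk0 : k ≠ 0 := by simpa using hk 0
    have hdvd : ¬ (2 * n : ℤ) ∣ ((2 * n + k : ℕ) : ℤ) := by
      intro h
      have h' : 2 * n ∣ 2 * n + k := by exact_mod_cast h
      obtain ⟨j, hj⟩ := (Nat.dvd_add_right (dvd_refl _)).1 h'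
      exact hk j (by rw [hj]; ring)
    simp only [hε, if_neg hk0, sumZeroes_T_of_not_dvd hdvd, mul_zero, sub_zero]
  -- The shift by 2n raises `j` by one and flips the sign, which the factor -1/2 in `ε` flips back.
  have hval : ∀ j : ℕ, sumZeroes n (T ℝ ((2 * n + 2 * j * n : ℕ) : ℤ)) = -(-1) ^ j * Real.pi := by
    intro j
    rw [show 2 * n + 2 * j * n = 2 * (j + 1) * n by ring, sumZeroes_T_two_mul_mul hn0]
    ring
  refine ⟨ε, fun f hf => ?_, fun j => hzero _ fun i => ?_, ?_, fun j hj => ?_, hzero⟩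
  · have h1 := (hasSum_chebyshevCoeff_mul_sumZeroes hn0 hf).mul_left (-(1 / 2) : ℂ)
    have h2 := (hasSum_ite_eq (0 : ℕ) (chebyshevCoeff f (2 * n) * (Real.pi / 4 : ℝ))).add h1
    have h3 : HasSum (fun k : ℕ => chebyshevCoeff f (2 * n + k) * (ε k : ℂ)) _ :=
      h2.congr_fun fun k => by
        rcases eq_or_ne k 0 with rfl | hk
        · simp only [hε, if_true, add_zero]
          push_cast
          ring
        · simp only [hε, if_neg hk]
          push_cast
          ring
    refine ⟨h3.summable, ?_⟩
    rw [h3.tsum_eq, remainderT_eq hn0 hf]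
    push_cast
    field_simp
    ring
  · rw [mul_assoc]
    lia
  · have := hval 0
    simp only [mul_zero, zero_mul, pow_zero] at this
    simp only [hε, if_true, this]
    ring
  · have : 2 * j * n ≠ 0 := by positivity
    simp only [hε, if_neg this, hval]
    ring
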